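/- Let $\mathbb F_q$ be a finite field of characteristic $p$, let $F$ be an algebraic function field in one variable over $\mathbb F_q$, and let $P_\infty, P_1,\dots,P_n$ be pairwise distinct rational places of $F$. Put $D=P_1+\dots+P_n$, and let $G$ and $A$ be divisors of $F$ whose supports are disjoint from that of $D$. For a divisor $B$ let $L(B)$ denote its Riemann–Roch space, and put $$Y=\bigcup_{m\ge 0}L(mP_\infty),\qquad Y(B)=\bigcup_{m\ge 0}L(B+mP_\infty),$$ so that $Y$ is a ring and $Y(B)$ is a $Y$-module. For a rational place $P$, $r\in\mathbb F_q$ and an integer $m \ge 0$, a polynomial $Q\in F[z]$ is said to have a root of multiplicity at least $m$ at $(P,r)$ if, for a local parameter $\phi$ of $P$, there are $c_{a,b}\in\mathbb F_q$ such that $Q(z)=\sum_{a,b\ge 0,\ a+b\ge m}c_{a,b}\phi^a(z-r)^b$ ($P$-adically). Let $e\ge 0$ and $0\le s\le \ell$ be integers, let $(r_1,\dots,r_n)\in\mathbb F_q^n$, and let $\mathcal M^{(e)}$ be the set of all polynomials $Q=\sum_{j=0}^{\ell}Q_jz^{p^ej}\in F[z]$ with $Q_j\in Y(A-p^ejG)$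 for $j=0,\dots,\ell$ that have a root of multiplicity at least $p^es$ at $(P_i,r_i)$ for each $i=1,\dots,n$. Let $R\in Y(G)$ be such that $R(P_i)=r_i$ for $i=1,\dots,n$. Then $\mathcal M^{(e)}$ is a $Y$-submodule of $F[z]$, and $$\mathcal M^{(e)}=\bigoplus_{j=0}^{s}(z-R)^{p^ej}\,Y(A+p^eG_j)\ \oplus\bigoplus_{j=s+1}^{\ell}(z-R)^{p^es}z^{p^e(j-s)}\,Y(A+p^eG_j)$$ as an internal direct sum of $Y$-submodules of $F[z]$, where $G_j=-jG-\max\{0,s-j\}D$ for $j=0,\dots,\ell$. -/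

import Mathlib

open scoped WithZero IntermediateField Polynomial

noncomputable section

namespace AGCode

/-- `F` is an algebraic function field in one variable over `k`: a finite extension of `k(x)` for
some `x ∈ F` that is transcendental over `k`. -/
def IsFunctionField (k F : Type*) [Field k] [Field F] [Algebra k F] : Prop :=
  ∃ x : F, Transcendental k x ∧ FiniteDimensional k⟮x⟯ F

/-- A place of `F / k`, given by its valuation ring `𝒪_P`: a discrete valuation ring that contains
`k` and has `F` as its field of fractions. -/
@[ext]
structure Place (k F : Type*) [Field k] [Field F] [Algebra k F] where
  ring : ValuationSubring F
  algebraMap_mem : ∀ c : k, algebraMap k F c ∈ ring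
  isDVR : IsDiscreteValuationRing ring

variable {k F : Type*} [Field k] [Field F] [Algebra k F]

namespace Place

instance (P : Place k F) : IsDiscreteValuationRing P.ring := P.isDVR

instance (P : Place k F) : Algebra k P.ring :=
  ((algebraMap k F).codRestrict P.ring.toSubring P.algebraMap_mem).toAlgebra

/-- The normalized discrete valuation of `P`, written multiplicatively: with `v_P` the usual
additive valuation, `P.val f = exp (-v_P(f))` for `f ≠ 0`, and `P.val 0 = 0`. So
`v_P(f) ≥ m` reads `P.val f ≤ exp (-m)`. -/
def val (P : Place k F) : Valuation F ℤᵐ⁰ :=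
  (IsDiscreteValuationRing.maximalIdeal P.ring).valuation F

/-- The degree of the residue field of `P` over `k`. -/
def degree (P : Place k F) : ℕ :=
  Module.finrank k (IsLocalRing.ResidueField P.ring)

def IsRational (P : Place k F) : Prop := P.degree = 1

/-- `f(P) = r`: `f` is regular at `P` and its residue class is the constant `r`. -/
def EvalEq (P : Place k F) (f : F) (r : k) : Prop :=
  ∃ hf : f ∈ P.ring,
    IsLocalRing.residue P.ring ⟨f, hf⟩ = algebraMap k (IsLocalRing.ResidueField P.ring) r

def IsLocalParameter (P : Place k F) (φ : F) : Prop := P.val φ = WithZero.exp (-1 : ℤ)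

/-- `f = ∑_{a ≥ 0} c_a φ^a` as a `P`-adically convergent series. -/
def IsExpansion (P : Place k F) (φ f : F) (c : ℕ → k) : Prop :=
  ∀ N : ℕ, P.val (f - ∑ a ∈ Finset.range N, algebraMap k F (c a) * φ ^ a) ≤
    WithZero.exp (-(N : ℤ))

/-- `Q` has a root of multiplicity at least `m` at `(P, r)`: for a local parameter `φ` at `P` there
are constants `c a b` with `Q(z) = ∑_{a, b ≥ 0} c_{a,b} φ^a (z - r)^b`, where only terms with
`a + b ≥ m` occur. The coefficient of `(z - r)^b` in `Q` is `(taylor r Q).coeff b`. -/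
def HasRootMultGE (P : Place k F) (r : k) (m : ℕ) (Q : F[X]) : Prop :=
  ∃ (φ : F) (c : ℕ → ℕ → k), P.IsLocalParameter φ ∧
    (∀ b, P.IsExpansion φ ((Polynomial.taylor (algebraMap k F r) Q).coeff b) (fun a => c a b)) ∧
    ∀ a b, a + b < m → c a b = 0

theorem val_algebraMap_le_one (P : Place k F) (c : k) : P.val (algebraMap k F c) ≤ 1 :=
  (IsDiscreteValuationRing.maximalIdeal P.ring).valuation_le_one
    (⟨algebraMap k F c, P.algebraMap_mem c⟩ : P.ring)

end Place

/-- Divisors of `F / k`. -/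
abbrev Divisor (k F : Type*) [Field k] [Field F] [Algebra k F] := Place k F →₀ ℤ

/-- The Riemann–Roch space `L(A)`, i.e. all `f ∈ F` with `f = 0` or
`v_P(f) ≥ -v_P(A)` for all places `P`. -/
def L (A : Divisor k F) : Submodule k F where
  carrier := {f | ∀ P : Place k F, P.val f ≤ WithZero.exp (A P)}
  zero_mem' P := by simp
  add_mem' hf hg P := (P.val.map_add _ _).trans (max_le (hf P) (hg P))
  smul_mem' c f hf P := by
    rw [Algebra.smul_def, map_mul]
    exact (mul_le_mul' (P.val_algebraMap_le_one c) (hf P)).trans_eq (one_mul _)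

theorem L_mono {A B : Divisor k F} (h : A ≤ B) : L A ≤ L B :=
  fun _ hf P => (hf P).trans (WithZero.exp_le_exp.2 (h P))

theorem mul_mem_L {A B : Divisor k F} {f g : F} (hf : f ∈ L A) (hg : g ∈ L B) :
    f * g ∈ L (A + B) := fun P => by
  rw [map_mul, Finsupp.add_apply, WithZero.exp_add]
  exact mul_le_mul' (hf P) (hg P)

/-- The ring `Y = ⋃_{m ≥ 0} L(m P∞)`. -/
def Y (Pinf : Place k F) : Subalgebra k F where
  carrier := {f | ∃ m : ℕ, f ∈ L (Finsupp.single Pinf (m : ℤ))}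
  mul_mem' := by
    rintro f g ⟨m, hf⟩ ⟨m', hg⟩
    refine ⟨m + m', ?_⟩
    rw [Nat.cast_add, Finsupp.single_add]
    exact mul_mem_L hf hg
  add_mem' := by
    rintro f g ⟨m, hf⟩ ⟨m', hg⟩
    refine ⟨max m m', add_mem (L_mono ?_ hf) (L_mono ?_ hg)⟩ <;>
    exact Finsupp.single_mono (by simp)
  algebraMap_mem' c := ⟨0, fun P => by simpa using P.val_algebraMap_le_one c⟩

/-- The `Y`-module `Y(A) = ⋃_{m ≥ 0} L(A + m P∞)`. -/
def YMod (Pinf : Place k F) (A : Divisor k F) : Submodule (Y Pinf) F where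
  carrier := {f | ∃ m : ℕ, f ∈ L (A + Finsupp.single Pinf (m : ℤ))}
  zero_mem' := ⟨0, zero_mem _⟩
  add_mem' := by
    rintro f g ⟨m, hf⟩ ⟨m', hg⟩
    refine ⟨max m m', add_mem (L_mono ?_ hf) (L_mono ?_ hg)⟩ <;>
    exact add_le_add_right (Finsupp.single_mono (by simp)) A
  smul_mem' := by
    rintro ⟨y, m, hy⟩ f ⟨m', hf⟩
    refine ⟨m + m', ?_⟩
    rw [Nat.cast_add, Finsupp.single_add, add_left_comm]
    exact mul_mem_L hy hf

/-- The divisor `P_1 + ⋯ + P_n`. -/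
def sumDivisor {n : ℕ} (P : Fin n → Place k F) : Divisor k F :=
  ∑ i, Finsupp.single (P i) 1

/-- The set of all `Q = ∑_{j=0}^ℓ Q_j z^{q j}` with `Q_j ∈ Y(A - q j G)` that have a root of
multiplicity at least `q s` at every `(P_i, r_i)`; here `q` stands for `p ^ e`. -/
def interpolationSet (Pinf : Place k F) {n : ℕ} (P : Fin n → Place k F) (G A : Divisor k F)
    (r : Fin n → k) (q s ℓ : ℕ) : Set F[X] :=
  {Q | (∃ c : ℕ → F, (∀ j ≤ ℓ, c j ∈ YMod Pinf (A - (q * j) • G)) ∧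
        Q = ∑ j ∈ Finset.range (ℓ + 1), Polynomial.C (c j) * Polynomial.X ^ (q * j)) ∧
      ∀ i, (P i).HasRootMultGE (r i) (q * s) Q}

/-- `G_j = -j G - max {0, s - j} D`. -/
def Gdiv (G D : Divisor k F) (s j : ℕ) : Divisor k F :=
  -((j : ℤ) • G) - max 0 ((s : ℤ) - (j : ℤ)) • D

/-- The `Y`-submodule `B · Y(A)` of `F[z]`, for a polynomial `B ∈ F[z]`. -/
def polyMulY (Pinf : Place k F) (B : F[X]) (A : Divisor k F) : Submodule (Y Pinf) F[X] :=
  (YMod Pinf A).map ((LinearMap.toSpanSingleton F F[X] B).restrictScalars (Y Pinf))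

/-- The `j`-th summand: `(z - R)^{q j} Y(A + q G_j)` if `j ≤ s`, and
`(z - R)^{q s} z^{q (j - s)} Y(A + q G_j)` if `j > s`. -/
def summand (Pinf : Place k F) (G D A : Divisor k F) (R : F) (q s j : ℕ) :
    Submodule (Y Pinf) F[X] :=
  polyMulY Pinf
    (if j ≤ s then (Polynomial.X - Polynomial.C R) ^ (q * j)
      else (Polynomial.X - Polynomial.C R) ^ (q * s) * Polynomial.X ^ (q * (j - s)))
    (A + q • Gdiv G D s j)

end AGCode

end

namespace AGCode

open Polynomial

/-! ### Local expansions and root multiplicities at a rational place. -/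

section Local

variable {k F : Type*} [Field k] [Field F] [Algebra k F]

namespace Place

/-! Put `q = p ^ e`. Every candidate is `Q(z) = B(z ^ q)`, and since Frobenius is additive, `Q(z +
R) = T(z ^ q)` with `T(z) = B(z + R ^ q)`. Both defining conditions become conditions on single
coefficients `T_j`. Since `R ^ q ∈ Y(qG)`, the condition `B_j ∈ Y(A - qjG)` for all `j` is invariant
under the shift (`taylor_mem_coeffSubmodule_iff`). Since `R - r_i` vanishes at `P_i`, the
multiplicity may be read off around `R` instead of `r_i`, and it says that `T_j` has order at least
`q max{0, s - j}` at `P_i`. Together they say `T_j ∈ Y(A + q G_j)` (`mem_interpolationSet_iff`).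

This gives the decomposition with powers of `z - R` throughout. From index `s` on, `D` no longer
occurs in `G_j`, so the cofactor of `(z - R) ^ (q * s)` may be shifted back and written in powers of
`z ^ q` under the same conditions (`exists_eq_sum_mixedBasis`, `taylor_mixedBasis_mem`). The sum is
direct because the basis polynomials have distinct degrees. -/

theorem val_le_exp_neg_one_of_lt_one {P : Place k F} {f : F} (h : P.val f < 1) :
    P.val f ≤ WithZero.exp (-1 : ℤ) := by
  by_cases h0 : P.val f = 0
  · simp [h0]
  · rw [← WithZero.exp_zero, ← WithZero.log_lt_iff_lt_exp h0] at h
    rw [← WithZero.log_le_iff_le_exp h0]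
    omega

theorem mem_ring_of_val_le_one {P : Place k F} {f : F} (h : P.val f ≤ 1) : f ∈ P.ring := by
  obtain ⟨a, rfl⟩ := IsDiscreteValuationRing.exists_lift_of_le_one (A := P.ring) h
  exact a.2

theorem EvalEq.val_sub_le {P : Place k F} {f : F} {r : k} (h : P.EvalEq f r) :
    P.val (f - algebraMap k F r) ≤ WithZero.exp (-1 : ℤ) := by
  obtain ⟨hf, h⟩ := h
  refine val_le_exp_neg_one_of_lt_one ?_
  have h' : IsLocalRing.residue P.ring (⟨f, hf⟩ - algebraMap k P.ring r) = 0 := by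
    rw [map_sub, h, sub_eq_zero]
    rfl
  rw [IsLocalRing.residue_eq_zero_iff] at h'
  exact ((IsDiscreteValuationRing.maximalIdeal P.ring).valuation_lt_one_iff_mem
    (K := F) _).2 h'

/-- Every function that is regular at a rational place has a value there. -/
theorem IsRational.exists_evalEq {P : Place k F} (hP : P.IsRational) {f : F}
    (hf : P.val f ≤ 1) : ∃ r : k, P.EvalEq f r := by
  obtain ⟨r, hr⟩ := (Algebra.finrank_eq_one_iff_bijective_algebraMap.1 hP).2
    (IsLocalRing.residue P.ring ⟨f, mem_ring_of_val_le_one hf⟩)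
  exact ⟨r, _, hr.symm⟩

theorem exists_isLocalParameter (P : Place k F) : ∃ φ : F, P.IsLocalParameter φ :=
  (IsDiscreteValuationRing.maximalIdeal P.ring).valuation_exists_uniformizer F

theorem IsLocalParameter.val_pow {P : Place k F} {φ : F} (hφ : P.IsLocalParameter φ) (N : ℕ) :
    P.val (φ ^ N) = WithZero.exp (-(N : ℤ)) := by
  rw [map_pow, hφ, ← WithZero.exp_nsmul]
  simp

theorem IsLocalParameter.ne_zero {P : Place k F} {φ : F} (hφ : P.IsLocalParameter φ) :
    φ ≠ 0 := by
  rintro rfl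
  exact WithZero.exp_ne_zero (hφ.symm.trans (map_zero _))

theorem IsRational.exists_eq_add_mul {P : Place k F} (hP : P.IsRational) {φ : F}
    (hφ : P.IsLocalParameter φ) (f : {f : F // P.val f ≤ 1}) :
    ∃ (c : k) (g : {f : F // P.val f ≤ 1}), f.1 = algebraMap k F c + φ * g.1 := by
  obtain ⟨c, hc⟩ := hP.exists_evalEq f.2
  refine ⟨c, ⟨(f.1 - algebraMap k F c) / φ, ?_⟩, ?_⟩
  · rw [map_div₀, hφ]
    exact div_le_one_of_le₀ hc.val_sub_le zero_le
  · have := hφ.ne_zero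
    field_simp
    ring

/-- Every function that is regular at a rational place has a power series expansion there. -/
theorem IsRational.exists_isExpansion {P : Place k F} (hP : P.IsRational) {φ : F}
    (hφ : P.IsLocalParameter φ) {f : F} (hf : P.val f ≤ 1) :
    ∃ c : ℕ → k, P.IsExpansion φ f c := by
  choose c g hcg using hP.exists_eq_add_mul hφ
  -- `g` removes the constant term and divides by `φ`, so `g^[N]` gives the remainder after `N`
  -- terms.
  refine ⟨fun a => c (g^[a] ⟨f, hf⟩), fun N => ?_⟩
  have key : f = ∑ a ∈ Finset.range N, algebraMap k F (c (g^[a] ⟨f, hf⟩)) * φ ^ a +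
      φ ^ N * (g^[N] ⟨f, hf⟩).1 := by
    induction N with
    | zero => simp
    | succ N ih =>
      rw [Finset.sum_range_succ, Function.iterate_succ_apply']
      have h := hcg (g^[N] ⟨f, hf⟩)
      rw [h] at ih
      linear_combination ih
  have key' : f - ∑ a ∈ Finset.range N, algebraMap k F (c (g^[a] ⟨f, hf⟩)) * φ ^ a =
      φ ^ N * (g^[N] ⟨f, hf⟩).1 := by
    linear_combination key
  rw [key', map_mul, hφ.val_pow]
  exact mul_le_of_le_one_right' (g^[N] ⟨f, hf⟩).2

theorem IsRational.exists_isExpansion_of_val_le {P : Place k F} (hP : P.IsRational) {φ : F}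
    (hφ : P.IsLocalParameter φ) {f : F} {N : ℕ} (hf : P.val f ≤ WithZero.exp (-(N : ℤ))) :
    ∃ c : ℕ → k, P.IsExpansion φ f c ∧ ∀ a < N, c a = 0 := by
  have hφ0 := hφ.ne_zero
  obtain ⟨c, hc⟩ := hP.exists_isExpansion hφ (f := f / φ ^ N) (by
    rw [map_div₀, hφ.val_pow]
    exact div_le_one_of_le₀ hf zero_le)
  refine ⟨fun a => if a < N then 0 else c (a - N), fun M => ?_, fun a ha => if_pos ha⟩
  rcases le_total M N with h | h
  · rw [Finset.sum_eq_zero, sub_zero]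
    · exact hf.trans (WithZero.exp_le_exp.2 (by omega))
    · intro a ha
      dsimp only
      rw [if_pos ((Finset.mem_range.1 ha).trans_le h), map_zero, zero_mul]
  · obtain ⟨M, rfl⟩ := Nat.exists_eq_add_of_le h
    have hsum : f - ∑ a ∈ Finset.range (N + M),
        algebraMap k F (if a < N then 0 else c (a - N)) * φ ^ a =
        φ ^ N * (f / φ ^ N - ∑ a ∈ Finset.range M, algebraMap k F (c a) * φ ^ a) := by
      rw [Finset.sum_range_add, Finset.sum_eq_zero (s := Finset.range N), zero_add, mul_sub,
        mul_div_cancel₀ _ (pow_ne_zero _ hφ0), Finset.mul_sum]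
      · congr 1
        refine Finset.sum_congr rfl fun a _ => ?_
        rw [if_neg (by omega), Nat.add_sub_cancel_left]
        ring
      · intro a ha
        rw [if_pos (Finset.mem_range.1 ha), map_zero, zero_mul]
    rw [hsum, map_mul, hφ.val_pow, Nat.cast_add, neg_add, WithZero.exp_add]
    exact mul_le_mul' le_rfl (hc M)

/-- At a rational place, the multiplicity of a root is read off from the valuations of the Taylor
coefficients. -/
theorem IsRational.hasRootMultGE_iff {P : Place k F} (hP : P.IsRational) {r : k} {m : ℕ}
    {Q : F[X]} : P.HasRootMultGE r m Q ↔
      ∀ b, P.val ((taylor (algebraMap k F r) Q).coeff b) ≤ WithZero.exp (-((m - b : ℕ) : ℤ)) := by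
  constructor
  · rintro ⟨φ, c, -, hc, h0⟩ b
    -- All of the first `m - b` terms vanish, so the error bound at this length bounds the
    -- coefficient itself.
    have h := hc b (m - b)
    rwa [Finset.sum_eq_zero, sub_zero] at h
    intro a ha
    dsimp only
    rw [h0 a b (by have := Finset.mem_range.1 ha; omega), map_zero, zero_mul]
  · intro h
    obtain ⟨φ, hφ⟩ := P.exists_isLocalParameter
    choose c hc h0 using fun b => hP.exists_isExpansion_of_val_le hφ (h b)
    exact ⟨φ, fun a b => c b a, hφ, hc, fun a b hab => h0 b a (by omega)⟩

end Place

end Local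

/-! ### Coefficientwise conditions and their invariance under Taylor shift. -/

section Coefficients

variable {S F : Type*} [CommRing S] [Field F] [Algebra S F]

/-- The polynomials whose `j`-th coefficient lies in `N j` for all `j`. -/
def coeffSubmodule (N : ℕ → Submodule S F) : Submodule S F[X] where
  carrier := {Q | ∀ j, Q.coeff j ∈ N j}
  zero_mem' j := by simp
  add_mem' hf hg j := by
    rw [coeff_add]
    exact add_mem (hf j) (hg j)
  smul_mem' c f hf j := by
    rw [coeff_smul]
    exact (N j).smul_mem c (hf j)

theorem pow_mul_mem_of_mul_mem {N : ℕ → Submodule S F} {t : F}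
    (hN : ∀ j, ∀ c ∈ N (j + 1), t * c ∈ N j) (i j : ℕ) {c : F} (hc : c ∈ N (j + i)) :
    t ^ i * c ∈ N j := by
  induction i generalizing c with
  | zero => simpa using hc
  | succ i ih =>
    rw [pow_succ, mul_assoc]
    exact ih (hN _ _ hc)

/-- The `j`-th coefficient of `Q(z + t)` is a sum of integer multiples of `t ^ (i - j) * Q_i` with
`i ≥ j`, and each factor `t` lowers the index of `N` by one. -/
theorem taylor_mem_coeffSubmodule {N : ℕ → Submodule S F} {t : F}
    (hN : ∀ j, ∀ c ∈ N (j + 1), t * c ∈ N j) {Q : F[X]} (hQ : Q ∈ coeffSubmodule N) :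
    taylor t Q ∈ coeffSubmodule N := by
  intro j
  rw [Q.as_sum_support, map_sum, finsetSum_coeff]
  refine sum_mem fun i _ => ?_
  rw [taylor_monomial, coeff_C_mul, coeff_X_add_C_pow]
  rcases le_or_gt j i with h | h
  · obtain ⟨i, rfl⟩ := Nat.exists_eq_add_of_le h
    have := nsmul_mem (pow_mul_mem_of_mul_mem hN i j (hQ (j + i))) ((j + i).choose j)
    rw [nsmul_eq_mul] at this
    rw [Nat.add_sub_cancel_left]
    convert this using 1
    ring
  · simp [Nat.choose_eq_zero_of_lt h]

theorem taylor_mem_coeffSubmodule_iff {N : ℕ → Submodule S F} {t : F}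
    (hN : ∀ j, ∀ c ∈ N (j + 1), t * c ∈ N j) {Q : F[X]} :
    taylor t Q ∈ coeffSubmodule N ↔ Q ∈ coeffSubmodule N := by
  refine ⟨fun h => ?_, taylor_mem_coeffSubmodule hN⟩
  have h' := taylor_mem_coeffSubmodule (t := -t)
    (fun j c hc => by rw [neg_mul]; exact neg_mem (hN j c hc)) h
  rwa [taylor_taylor, neg_add_cancel, taylor_zero] at h'

/-- The family `N` up to the index `d`, continued by `⊥`. -/
def truncate (N : ℕ → Submodule S F) (d j : ℕ) : Submodule S F := if j ≤ d then N j else ⊥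

theorem mem_truncate {N : ℕ → Submodule S F} {d j : ℕ} {c : F} :
    c ∈ truncate N d j ↔ c ∈ N j ∧ (d < j → c = 0) := by
  unfold truncate
  split_ifs with h
  · simp [h.not_gt]
  · rw [Submodule.mem_bot]
    exact ⟨fun hc => ⟨hc ▸ zero_mem _, fun _ => hc⟩, fun hc => hc.2 (not_le.1 h)⟩

theorem mul_mem_truncate {N : ℕ → Submodule S F} {t : F}
    (hN : ∀ j, ∀ c ∈ N (j + 1), t * c ∈ N j) (d j : ℕ) (c : F)
    (hc : c ∈ truncate N d (j + 1)) : t * c ∈ truncate N d j := by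
  rw [mem_truncate] at hc ⊢
  exact ⟨hN j c hc.1, fun h => by rw [hc.2 (by omega), mul_zero]⟩

theorem eq_sum_of_mem_truncate {N : ℕ → Submodule S F} {d : ℕ} {Q : F[X]}
    (hQ : Q ∈ coeffSubmodule (truncate N d)) :
    Q = ∑ j ∈ Finset.range (d + 1), C (Q.coeff j) * X ^ j := by
  refine Q.as_sum_range_C_mul_X_pow' ?_
  rw [Nat.lt_succ_iff, natDegree_le_iff_coeff_eq_zero]
  exact fun j hj => (mem_truncate.1 (hQ j)).2 hj

end Coefficients

/-! ### Frobenius and the mixed basis. -/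

theorem taylor_expand_pow {F : Type*} [Field F] (p e : ℕ) [ExpChar F p] (t : F) (B : F[X]) :
    taylor t (expand F (p ^ e) B) = expand F (p ^ e) (taylor (t ^ p ^ e) B) := by
  simp only [taylor_apply, expand_eq_comp_X_pow, comp_assoc, pow_comp, add_comp, X_comp, C_comp,
    add_pow_expChar_pow, C_pow]

theorem X_sub_C_pow_mul {F : Type*} [Field F] (p e : ℕ) [ExpChar F p] (t : F) (j : ℕ) :
    (X - C t) ^ (p ^ e * j) = expand F (p ^ e) ((X - C (t ^ p ^ e)) ^ j) := by
  rw [pow_mul, sub_pow_expChar_pow]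
  simp

theorem sum_mem_coeffSubmodule_truncate {S F : Type*} [CommRing S] [Field F] [Algebra S F]
    {N : ℕ → Submodule S F} {d : ℕ} {c : ℕ → F} (hc : ∀ j ≤ d, c j ∈ N j) :
    ∑ j ∈ Finset.range (d + 1), C (c j) * X ^ j ∈ coeffSubmodule (truncate N d) := by
  intro j
  rw [mem_truncate, finsetSum_coeff]
  simp only [coeff_C_mul, coeff_X_pow, mul_ite, mul_one, mul_zero, Finset.sum_ite_eq,
    Finset.mem_range, Nat.lt_succ_iff]
  split_ifs with h
  · exact ⟨hc j h, fun h' => absurd h h'.not_ge⟩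
  · exact ⟨zero_mem _, fun _ => rfl⟩

/-- The polynomials `(z - t)^j` for `j ≤ s` and `(z - t)^s z^{j - s}` for `j > s`. -/
noncomputable def mixedBasis {F : Type*} [Field F] (t : F) (s j : ℕ) : F[X] :=
  if j ≤ s then (X - C t) ^ j else (X - C t) ^ s * X ^ (j - s)

theorem mixedBasis_of_le {F : Type*} [Field F] (t : F) {s j : ℕ} (h : j ≤ s) :
    mixedBasis t s j = (X - C t) ^ j := if_pos h

theorem mixedBasis_add {F : Type*} [Field F] (t : F) (s i : ℕ) :
    mixedBasis t s (s + i) = (X - C t) ^ s * X ^ i := by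
  rcases i.eq_zero_or_pos with rfl | h
  · simp [mixedBasis]
  · rw [mixedBasis, if_neg (by omega), Nat.add_sub_cancel_left]

theorem degree_mixedBasis {F : Type*} [Field F] (t : F) (s j : ℕ) :
    (mixedBasis t s j).degree = j := by
  rcases le_total j s with h | h
  · rw [mixedBasis_of_le t h, degree_pow, degree_X_sub_C, nsmul_one]
  · obtain ⟨i, rfl⟩ := Nat.exists_eq_add_of_le h
    rw [mixedBasis_add, degree_mul, degree_pow, degree_X_sub_C, degree_X_pow, nsmul_one,
      Nat.cast_add]

theorem linearIndependent_expand_mixedBasis {F : Type*} [Field F] (t : F) (s : ℕ) {q : ℕ}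
    (hq : 0 < q) : LinearIndependent F fun j => expand F q (mixedBasis t s j) := by
  let B : Polynomial.Sequence F := ⟨mixedBasis t s, degree_mixedBasis t s⟩
  exact B.linearIndependent.map' (expand F q).toLinearMap
    (LinearMap.ker_eq_bot.2 (expand_injective hq))

theorem expand_mixedBasis {F : Type*} [Field F] (p e : ℕ) [ExpChar F p] (t : F) (s j : ℕ) :
    expand F (p ^ e) (mixedBasis (t ^ p ^ e) s j) =
      if j ≤ s then (X - C t) ^ (p ^ e * j)
        else (X - C t) ^ (p ^ e * s) * X ^ (p ^ e * (j - s)) := by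
  unfold mixedBasis
  split_ifs
  · rw [X_sub_C_pow_mul]
  · rw [X_sub_C_pow_mul, map_mul, map_pow _ X, expand_X, pow_mul]

/-! ### The modules `Y(B)` and the conditions at the `P_i`. -/

variable {k F : Type*} [Field k] [Field F] [Algebra k F]

theorem mul_mem_YMod {Pinf : Place k F} {A B : Divisor k F} {f g : F}
    (hf : f ∈ YMod Pinf A) (hg : g ∈ YMod Pinf B) : f * g ∈ YMod Pinf (A + B) := by
  obtain ⟨m, hf⟩ := hf
  obtain ⟨m', hg⟩ := hg
  refine ⟨m + m', ?_⟩
  rw [Nat.cast_add, Finsupp.single_add, add_add_add_comm]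
  exact mul_mem_L hf hg

theorem pow_mem_YMod {Pinf : Place k F} {A : Divisor k F} {f : F} (hf : f ∈ YMod Pinf A)
    (m : ℕ) : f ^ m ∈ YMod Pinf (m • A) := by
  induction m with
  | zero => exact ⟨0, fun P => by simp⟩
  | succ m ih =>
    rw [pow_succ, succ_nsmul]
    exact mul_mem_YMod ih hf

section SumDivisor

variable {n : ℕ} {P : Fin n → Place k F}

theorem sumDivisor_apply (hP : Function.Injective P) (i : Fin n) : sumDivisor P (P i) = 1 := by
  classical
  simp [sumDivisor, Finsupp.finsetSum_apply, Finsupp.single_apply, hP.eq_iff]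

theorem sumDivisor_apply_of_ne {Q : Place k F} (hQ : ∀ i, P i ≠ Q) : sumDivisor P Q = 0 := by
  classical
  simp [sumDivisor, Finsupp.finsetSum_apply, hQ]

theorem apply_eq_zero_of_disjoint (hP : Function.Injective P) {B : Divisor k F}
    (hB : Disjoint B.support (sumDivisor P).support) (i : Fin n) : B (P i) = 0 := by
  by_contra h
  exact Finset.disjoint_left.1 hB (Finsupp.mem_support_iff.2 h)
    (Finsupp.mem_support_iff.2 (by simp [sumDivisor_apply hP]))

/-- Neither `B` nor `P∞` contributes at the `P_i`, and `D` contributes nowhere else, so subtracting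
`t • D` only imposes zeros of order `t` at the `P_i`. -/
theorem mem_YMod_sub_sumDivisor_iff (hP : Function.Injective P) {Pinf : Place k F}
    (hPinf : ∀ i, P i ≠ Pinf) {B : Divisor k F} (hB : ∀ i, B (P i) = 0) {t : ℕ} {f : F} :
    f ∈ YMod Pinf (B - t • sumDivisor P) ↔
      f ∈ YMod Pinf B ∧ ∀ i, (P i).val f ≤ WithZero.exp (-(t : ℤ)) := by
  have hsing (i : Fin n) (m : ℤ) : Finsupp.single Pinf m (P i) = 0 :=
    Finsupp.single_eq_of_ne (hPinf i)
  constructor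
  · rintro ⟨m, hf⟩
    refine ⟨⟨m, fun Q => ?_⟩, fun i => ?_⟩
    · refine (hf Q).trans (WithZero.exp_le_exp.2 ?_)
      by_cases hQ : ∃ i, P i = Q
      · obtain ⟨i, rfl⟩ := hQ
        simp [sumDivisor_apply hP]
      · push Not at hQ
        simp [sumDivisor_apply_of_ne hQ]
    · simpa [hB, hsing, sumDivisor_apply hP] using hf (P i)
  · rintro ⟨⟨m, hf⟩, h⟩
    refine ⟨m, fun Q => ?_⟩
    by_cases hQ : ∃ i, P i = Q
    · obtain ⟨i, rfl⟩ := hQ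
      simpa [hB, hsing, sumDivisor_apply hP] using h i
    · push Not at hQ
      simpa [sumDivisor_apply_of_ne hQ] using hf Q

end SumDivisor

/-- Truncated subtraction in `ℕ` replaces the maximum, matching the exponent in the root condition.
-/
theorem add_smul_Gdiv (A G D : Divisor k F) (q s j : ℕ) :
    A + q • Gdiv G D s j = A - (q * j) • G - (q * s - q * j) • D := by
  ext Q
  rcases le_total s j with h | h
  · have h' : q * s - q * j = 0 := Nat.sub_eq_zero_of_le (Nat.mul_le_mul_left q h)
    have hmax : max 0 ((s : ℤ) - j) = 0 := max_eq_left (by omega)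
    simp [Gdiv, h', hmax]
    ring
  · obtain ⟨d, rfl⟩ := Nat.exists_eq_add_of_le h
    have h' : q * (j + d) - q * j = q * d := by rw [mul_add, Nat.add_sub_cancel_left]
    have hmax : max 0 (((j + d : ℕ) : ℤ) - j) = d := by rw [max_eq_right] <;> push_cast <;> omega
    simp only [Gdiv, h', hmax, Finsupp.add_apply, Finsupp.sub_apply, Finsupp.smul_apply,
      Finsupp.neg_apply, nsmul_eq_mul, smul_eq_mul]
    push_cast
    ring

theorem add_smul_Gdiv_of_le (A G D : Divisor k F) (q : ℕ) {s j : ℕ} (h : s ≤ j) :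
    A + q • Gdiv G D s j = A - (q * j) • G := by
  rw [add_smul_Gdiv, Nat.sub_eq_zero_of_le (Nat.mul_le_mul_left q h), zero_smul, sub_zero]

theorem mem_summand_iff (p e : ℕ) [ExpChar F p] {Pinf : Place k F} {G D A : Divisor k F} {R : F}
    {s j : ℕ} {Q : F[X]} :
    Q ∈ summand Pinf G D A R (p ^ e) s j ↔ ∃ f ∈ YMod Pinf (A + p ^ e • Gdiv G D s j),
      expand F (p ^ e) (C f * mixedBasis (R ^ p ^ e) s j) = Q := by
  rw [summand, ← expand_mixedBasis, polyMulY]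
  simp only [← smul_eq_C_mul, map_smul]
  exact Iff.rfl

/-- The functions `f` with `v_P(f) ≥ -N`. -/
def Place.valSubmodule (P : Place k F) (N : ℤ) : Submodule k F where
  carrier := {f | P.val f ≤ WithZero.exp N}
  zero_mem' := by simp
  add_mem' hf hg := (P.val.map_add _ _).trans (max_le hf hg)
  smul_mem' c f hf := by
    rw [Set.mem_ofPred_eq, Algebra.smul_def, map_mul]
    exact (mul_le_mul' (P.val_algebraMap_le_one c) hf).trans_eq (one_mul _)

theorem Place.mem_valSubmodule {P : Place k F} {N : ℤ} {f : F} :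
    f ∈ P.valSubmodule N ↔ P.val f ≤ WithZero.exp N := Iff.rfl

/-- The multiplicity of a root at `(P, r)` can be read off from the Taylor expansion around any
function with value `r` at `P`. -/
theorem Place.IsRational.hasRootMultGE_iff_of_evalEq {P : Place k F} (hP : P.IsRational) {r : k}
    {R : F} (hR : P.EvalEq R r) {m : ℕ} {Q : F[X]} : P.HasRootMultGE r m Q ↔
      ∀ b, P.val ((taylor R Q).coeff b) ≤ WithZero.exp (-((m - b : ℕ) : ℤ)) := by
  -- Multiplication by `R - r` gains one order at `P`, which is the most that `m - b` can differ
  -- between consecutive `b`.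
  have hN (b : ℕ) (c : F) (hc : c ∈ P.valSubmodule (-((m - (b + 1) : ℕ) : ℤ))) :
      (R - algebraMap k F r) * c ∈ P.valSubmodule (-((m - b : ℕ) : ℤ)) := by
    rw [mem_valSubmodule] at hc ⊢
    rw [map_mul]
    refine (mul_le_mul' hR.val_sub_le hc).trans ?_
    rw [← WithZero.exp_add, WithZero.exp_le_exp]
    omega
  have h := taylor_mem_coeffSubmodule_iff (N := fun b => P.valSubmodule (-((m - b : ℕ) : ℤ))) hN
    (Q := taylor (algebraMap k F r) Q)
  rw [taylor_taylor, sub_add_cancel] at h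
  rw [hP.hasRootMultGE_iff]
  exact h.symm

/-! ### The interpolation module and its decomposition. -/

section Interpolation

variable {Pinf : Place k F} {n : ℕ} {P : Fin n → Place k F} {G A : Divisor k F} {r : Fin n → k}
  {R : F} {s ℓ : ℕ}

theorem pow_mul_mem_YMod_sub (hR : R ∈ YMod Pinf G) (q j : ℕ) {c : F}
    (hc : c ∈ YMod Pinf (A - (q * (j + 1)) • G)) : R ^ q * c ∈ YMod Pinf (A - (q * j) • G) := by
  have h := mul_mem_YMod (pow_mem_YMod hR q) hc
  have heq : q • G + (A - (q * (j + 1)) • G) = A - (q * j) • G := by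
    rw [mul_add, add_smul, mul_one]
    abel
  rwa [heq] at h

theorem exists_coeff_iff (N : ℕ → Submodule (Y Pinf) F) (q : ℕ) (Q : F[X]) :
    (∃ c : ℕ → F, (∀ j ≤ ℓ, c j ∈ N j) ∧
        Q = ∑ j ∈ Finset.range (ℓ + 1), C (c j) * X ^ (q * j)) ↔
      ∃ B ∈ coeffSubmodule (truncate N ℓ), expand F q B = Q := by
  constructor
  · rintro ⟨c, hc, rfl⟩
    exact ⟨_, sum_mem_coeffSubmodule_truncate hc, by simp [pow_mul]⟩
  · rintro ⟨B, hB, rfl⟩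
    refine ⟨B.coeff, fun j _ => (mem_truncate.1 (hB j)).1, ?_⟩
    conv_lhs => rw [eq_sum_of_mem_truncate hB]
    simp [pow_mul]

/-- The interpolation conditions decouple for the Taylor coefficients around `R ^ p ^ e`. -/
theorem mem_interpolationSet_iff (p e : ℕ) [ExpChar F p] (hP_inj : Function.Injective P)
    (hP_rat : ∀ i, (P i).IsRational) (hPinf : ∀ i, P i ≠ Pinf)
    (hG : Disjoint G.support (sumDivisor P).support)
    (hA : Disjoint A.support (sumDivisor P).support)
    (hR : R ∈ YMod Pinf G) (hRr : ∀ i, (P i).EvalEq R (r i)) (Q : F[X]) :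
    Q ∈ interpolationSet Pinf P G A r (p ^ e) s ℓ ↔
      ∃ B : F[X], taylor (R ^ p ^ e) B ∈ coeffSubmodule (truncate
        (fun j => YMod Pinf (A + p ^ e • Gdiv G (sumDivisor P) s j)) ℓ) ∧
        expand F (p ^ e) B = Q := by
  have hq : 0 < p ^ e := expChar_pow_pos F p e
  have hzero (j : ℕ) (i : Fin n) : (A - (p ^ e * j) • G) (P i) = 0 := by
    simp [apply_eq_zero_of_disjoint hP_inj hA, apply_eq_zero_of_disjoint hP_inj hG]
  have hroot (B : F[X]) (i : Fin n) :
      (P i).HasRootMultGE (r i) (p ^ e * s) (expand F (p ^ e) B) ↔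
        ∀ j, (P i).val ((taylor (R ^ p ^ e) B).coeff j) ≤
          WithZero.exp (-((p ^ e * s - p ^ e * j : ℕ) : ℤ)) := by
    rw [(hP_rat i).hasRootMultGE_iff_of_evalEq (hRr i), taylor_expand_pow]
    refine ⟨fun h j => ?_, fun h b => ?_⟩
    · have := h (p ^ e * j)
      rwa [coeff_expand_mul' hq] at this
    · rw [coeff_expand hq]
      split_ifs with hb
      · obtain ⟨j, rfl⟩ := hb
        rw [Nat.mul_div_cancel_left _ hq]
        exact h j
      · simp
  refine (and_congr_left' (exists_coeff_iff
    (fun j => YMod Pinf (A - (p ^ e * j) • G)) (p ^ e) Q)).trans ?_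
  constructor
  · rintro ⟨⟨B, hB, rfl⟩, h⟩
    refine ⟨B, fun j => ?_, rfl⟩
    have hB' := mem_truncate.1 (taylor_mem_coeffSubmodule
      (mul_mem_truncate (fun j c hc => pow_mul_mem_YMod_sub hR (p ^ e) j hc) ℓ) hB j)
    rw [mem_truncate, add_smul_Gdiv, mem_YMod_sub_sumDivisor_iff hP_inj hPinf (hzero j)]
    exact ⟨⟨hB'.1, fun i => (hroot B i).1 (h i) j⟩, hB'.2⟩
  · rintro ⟨B, hB, rfl⟩
    have hB' (j : ℕ) := mem_truncate.1 (hB j)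
    simp only [add_smul_Gdiv, mem_YMod_sub_sumDivisor_iff hP_inj hPinf (hzero _)] at hB'
    refine ⟨⟨B, ?_, rfl⟩, fun i => (hroot B i).2 fun j => (hB' j).1.2 i⟩
    rw [← taylor_mem_coeffSubmodule_iff
      (mul_mem_truncate (fun j c hc => pow_mul_mem_YMod_sub hR (p ^ e) j hc) ℓ)]
    exact fun j => mem_truncate.2 ⟨(hB' j).1.1, (hB' j).2⟩

theorem mul_mem_truncate_add (hR : R ∈ YMod Pinf G) (q s d j : ℕ) (c : F)
    (hc : c ∈ truncate (fun i => YMod Pinf (A - (q * (s + i)) • G)) d (j + 1)) :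
    R ^ q * c ∈ truncate (fun i => YMod Pinf (A - (q * (s + i)) • G)) d j :=
  mul_mem_truncate (fun j _ hc => pow_mul_mem_YMod_sub hR q (s + j) hc) d j c hc

/-- For `j ≤ s` the shift gives a monomial. For `j = s + d` it gives `X ^ s` times the shift of `f X
^ d`, whose coefficients meet the conditions because these are free of `D` from index `s` on. -/
theorem taylor_mixedBasis_mem (q : ℕ) (D : Divisor k F) (hR : R ∈ YMod Pinf G)
    {j : ℕ} (hj : j ≤ ℓ) {f : F} (hf : f ∈ YMod Pinf (A + q • Gdiv G D s j)) :
    taylor (R ^ q) (C f * mixedBasis (R ^ q) s j) ∈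
      coeffSubmodule (truncate (fun j => YMod Pinf (A + q • Gdiv G D s j)) ℓ) := by
  have hX : taylor (R ^ q) (X - C (R ^ q)) = X := by
    rw [map_sub, taylor_X, taylor_C, add_sub_cancel_right]
  intro i
  rw [mem_truncate]
  rcases le_total j s with h | h
  · rw [mixedBasis_of_le _ h, taylor_mul, taylor_C, taylor_pow, hX, coeff_C_mul_X_pow]
    split_ifs with hij
    · exact ⟨hij ▸ hf, fun h' => absurd hj (by omega)⟩
    · exact ⟨zero_mem _, fun _ => rfl⟩
  · obtain ⟨d, rfl⟩ := Nat.exists_eq_add_of_le h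
    rw [add_smul_Gdiv_of_le _ _ _ _ h] at hf
    have hmem : C f * X ^ d ∈
        coeffSubmodule (truncate (fun i => YMod Pinf (A - (q * (s + i)) • G)) (ℓ - s)) := by
      intro i
      rw [mem_truncate, coeff_C_mul_X_pow]
      split_ifs with hi
      · exact ⟨hi ▸ hf, fun h' => by omega⟩
      · exact ⟨zero_mem _, fun _ => rfl⟩
    have hT := taylor_mem_coeffSubmodule (mul_mem_truncate_add hR q s (ℓ - s)) hmem
    rw [mixedBasis_add, mul_left_comm, taylor_mul, taylor_pow, hX, coeff_X_pow_mul']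
    split_ifs with hi
    · obtain ⟨i, rfl⟩ := Nat.exists_eq_add_of_le hi
      rw [Nat.add_sub_cancel_left, add_smul_Gdiv_of_le _ _ _ _ hi]
      have := mem_truncate.1 (hT i)
      exact ⟨this.1, fun h' => this.2 (by omega)⟩
    · exact ⟨zero_mem _, fun _ => rfl⟩

theorem exists_eq_sum_mixedBasis (q : ℕ) (D : Divisor k F) (hR : R ∈ YMod Pinf G) (hsℓ : s ≤ ℓ)
    {B : F[X]} (hB : taylor (R ^ q) B ∈
      coeffSubmodule (truncate (fun j => YMod Pinf (A + q • Gdiv G D s j)) ℓ)) :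
    ∃ f : ℕ → F, (∀ j ≤ ℓ, f j ∈ YMod Pinf (A + q • Gdiv G D s j)) ∧
      B = ∑ j ∈ Finset.range (ℓ + 1), C (f j) * mixedBasis (R ^ q) s j := by
  obtain ⟨d, rfl⟩ := Nat.exists_eq_add_of_le hsℓ
  set T := taylor (R ^ q) B with hT
  have hBT : B = taylor (-R ^ q) T := by
    rw [hT, taylor_taylor, neg_add_cancel, taylor_zero]
  have hcoeff (j : ℕ) := (mem_truncate.1 (hB j)).1
  -- `T` splits as its part below degree `s` plus `X ^ s * H`. Only `H` must be rewritten in powers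
  -- of `z`, as `U`.
  let H : F[X] := ∑ i ∈ Finset.range (d + 1), C (T.coeff (s + i)) * X ^ i
  have hH : H ∈ coeffSubmodule (truncate (fun i => YMod Pinf (A - (q * (s + i)) • G)) d) := by
    refine sum_mem_coeffSubmodule_truncate fun i _ => ?_
    have := hcoeff (s + i)
    rwa [add_smul_Gdiv_of_le _ _ _ _ (Nat.le_add_right s i)] at this
  have hU := (taylor_mem_coeffSubmodule (t := -R ^ q) (fun j c hc => by
    rw [neg_mul]
    exact neg_mem (mul_mem_truncate_add hR q s d j c hc)) hH)
  set U := taylor (-R ^ q) H with hUdef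
  have hTsum : T = ∑ j ∈ Finset.range s, C (T.coeff j) * X ^ j + X ^ s * H := by
    conv_lhs => rw [eq_sum_of_mem_truncate hB, add_assoc, Finset.sum_range_add]
    simp only [H, Finset.mul_sum, pow_add, mul_left_comm]
  have hX : taylor (-R ^ q) X = X - C (R ^ q) := by rw [taylor_X, C_neg, sub_eq_add_neg]
  refine ⟨fun j => if j < s then T.coeff j else U.coeff (j - s), fun j hj => ?_, ?_⟩
  · dsimp only
    split_ifs with h
    · exact hcoeff j
    · obtain ⟨i, rfl⟩ := Nat.exists_eq_add_of_le (not_lt.1 h)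
      rw [Nat.add_sub_cancel_left, add_smul_Gdiv_of_le _ _ _ _ (Nat.le_add_right s i)]
      exact (mem_truncate.1 (hU i)).1
  · have hBsum : B = ∑ j ∈ Finset.range s, taylor (-R ^ q) (C (T.coeff j) * X ^ j) +
        ∑ i ∈ Finset.range (d + 1), (X - C (R ^ q)) ^ s * (C (U.coeff i) * X ^ i) := by
      rw [← Finset.mul_sum, ← eq_sum_of_mem_truncate hU, hUdef, ← hX, ← taylor_pow, ← taylor_mul,
        ← map_sum, ← map_add, ← hTsum, ← hBT]
    rw [add_assoc s d 1, Finset.sum_range_add]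
    refine hBsum.trans (congrArg₂ _ ?_ ?_)
    · refine Finset.sum_congr rfl fun j hj => ?_
      have hj := Finset.mem_range.1 hj
      dsimp only
      rw [if_pos hj, mixedBasis_of_le _ hj.le, taylor_mul, taylor_C, taylor_pow, hX]
    · refine Finset.sum_congr rfl fun i _ => ?_
      dsimp only
      rw [if_neg (by omega), Nat.add_sub_cancel_left, mixedBasis_add, mul_left_comm]

theorem iSupIndep_summand (p e : ℕ) [ExpChar F p] (D : Divisor k F) :
    iSupIndep (fun j : Fin (ℓ + 1) => summand Pinf G D A R (p ^ e) s j) := by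
  rw [iSupIndep_iff_finsetSum_eq_zero_imp_eq_zero]
  intro t v hv hsum j hj
  -- Membership in a summand supplies a scalar in `F`, so independence over `Y` reduces to linear
  -- independence over `F`.
  have hv' (j : Fin (ℓ + 1)) : ∃ f : F, j ∈ t →
      f • expand F (p ^ e) (mixedBasis (R ^ p ^ e) s j) = v j := by
    by_cases hj : j ∈ t
    · obtain ⟨f, -, hf⟩ := (mem_summand_iff p e).1 (hv j hj)
      refine ⟨f, fun _ => ?_⟩
      rw [← hf, map_mul, expand_C, smul_eq_C_mul]
    · exact ⟨0, fun h => absurd h hj⟩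
  choose f hf using hv'
  have hlin := (linearIndependent_expand_mixedBasis (R ^ p ^ e) s
    (expChar_pow_pos F p e)).comp ((↑) : Fin (ℓ + 1) → ℕ) Fin.val_injective
  rw [linearIndependent_iff'] at hlin
  rw [← hf j hj, hlin t f ((Finset.sum_congr rfl hf).trans hsum) j hj, zero_smul]

end Interpolation

end AGCode

open AGCode in
theorem theorem4p2 {k F : Type*} [Field k] [Finite k] [Field F] [Algebra k F]
    (hF : IsFunctionField k F) (p : ℕ) [CharP k p]
    (n : ℕ) (P : Fin n → Place k F) (hP_inj : Function.Injective P)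
    (hP_rat : ∀ i, (P i).IsRational)
    (Pinf : Place k F) (hPinf_rat : Pinf.IsRational) (hPinf : ∀ i, P i ≠ Pinf)
    (G A : Divisor k F)
    (hG : Disjoint G.support (sumDivisor P).support)
    (hA : Disjoint A.support (sumDivisor P).support)
    (e s ℓ : ℕ) (hsℓ : s ≤ ℓ)
    (r : Fin n → k) (R : F) (hR : R ∈ YMod Pinf G) (hRr : ∀ i, (P i).EvalEq R (r i)) :
    iSupIndep (fun j : Fin (ℓ + 1) => summand Pinf G (sumDivisor P) A R (p ^ e) s j) ∧
    interpolationSet Pinf P G A r (p ^ e) s ℓ =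
      ((⨆ j : Fin (ℓ + 1), summand Pinf G (sumDivisor P) A R (p ^ e) s j :
        Submodule (Y Pinf) (Polynomial F)) : Set (Polynomial F)) := by
  have hp : p.Prime := CharP.char_is_prime k p
  have : CharP F p := charP_of_injective_algebraMap (algebraMap k F).injective p
  have : ExpChar F p := ExpChar.prime hp
  refine ⟨iSupIndep_summand p e _, Set.ext fun Q => ?_⟩
  rw [mem_interpolationSet_iff p e hP_inj hP_rat hPinf hG hA hR hRr, SetLike.mem_coe]
  constructor
  · rintro ⟨B, hB, rfl⟩
    obtain ⟨f, hf, rfl⟩ := exists_eq_sum_mixedBasis (p ^ e) _ hR hsℓ hB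
    rw [map_sum]
    refine sum_mem fun j hj => ?_
    have hj := Finset.mem_range.1 hj
    exact Submodule.mem_iSup_of_mem (⟨j, hj⟩ : Fin (ℓ + 1))
      ((mem_summand_iff p e).2 ⟨f j, hf j (Nat.lt_succ_iff.1 hj), rfl⟩)
  · intro hQ
    induction hQ using Submodule.iSup_induction' with
    | mem j Q hQ =>
      obtain ⟨f, hf, rfl⟩ := (mem_summand_iff p e).1 hQ
      exact ⟨_, taylor_mixedBasis_mem (p ^ e) _ hR (Nat.lt_succ_iff.1 j.2) hf, rfl⟩
    | zero => exact ⟨0, by simp, map_zero _⟩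
    | add Q Q' _ _ hQ hQ' =>
      obtain ⟨B, hB, rfl⟩ := hQ
      obtain ⟨B', hB', rfl⟩ := hQ'
      exact ⟨B + B', by rw [map_add]; exact add_mem hB hB', map_add _ _ _⟩
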